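/- Let $\mathbb{F}_q$ be the field with $q$ elements and $a\in\mathbb{F}_q^*$. A linear code $C\subseteq\mathbb{F}_q^n$ is an $[n,k,d]_q$-code if $\dim C=k$ and its minimum Hamming distance is exactly $d$. It is quasi-twisted (QT) of index $\ell$ with shift constant $a$, where $\ell\ge 1$ divides $n$, if $(c_0,\dots,c_{n-1})\in C$ implies $(ac_{n-\ell},\dots,ac_{n-1},c_0,\dots,c_{n-\ell-1})\in C$. For a polynomial $c_0+c_1x+\cdots+c_{m-1}x^{m-1}$, its $a$-circulant matrix is the $m\times m$ matrix with first row $(c_0,\dots,c_{m-1})$ in which each row $(r_0,\dots,r_{m-1})$ is followed by $(ar_{m-1},r_0,\dots,r_{m-2})$. For polynomials $g_1,\dots,g_\ell$ of degree less than $m$, with $a$-circulant matrices $G_1,\dots,G_\ell$, let $C_m(g_1,\dots,g_\ell)$ be the row space of $[G_1\,|\,G_2\,|\cdots|\,G_\ell]$. A digit string denotes the polynomial whose coefficients are its digits, starting with the constant term (missing coefficients are $0$). With $a=1$, each of the following five codes $C_m(g_1,\dots,g_\ell)$ has exactly the stated parameters, and it becomes a QT code of index $\ell$ with shift constant $1$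 when its columns are permuted so that column $j$ of block $b$ ($0\le j<m$, $0\le b<\ell$) is put at position $j\ell+b$. 1. $[85,16,45]_5$: $m=17$, $\ell=5$, with $g_1=1331311000103332$, $g_2=2030141001241411$, $g_3=3412143022013031$, $g_4=1123200013130012$, $g_5=4233002104312041$. 2. $[84,19,41]_5$: $m=21$, $\ell=4$, with $g_1=44010311002304111222$, $g_2=141032024233443231$, $g_3=1310443344442044020$, $g_4=4011113222243123010$. 3. $[84,13,48]_5$: $m=14$, $\ell=6$, with $g_1=34030034422424$, $g_2=4023414111414$, $g_3=10342023404034$, $g_4=44300024241344$, $g_5=3221030030213$, $g_6=433111043203$. 4. $[65,12,39]_7$: $m=13$, $\ell=5$, with $g_1=2322660251501$, $g_2=4415215004556$, $g_3=1551620013551$, $g_4=4030032120616$, $g_5=4626364150311$. 5. $[78,13,47]_7$: $m=13$, $\ell=6$, with $g_1=6536106450546$, $g_2=640410515651$, $g_3=32251003506$, $g_4=524220205542$, $g_5=520330333466$, $g_6=15211116242$. -/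

import Mathlib

namespace QTCode

instance fact_prime_five : Fact (Nat.Prime 5) := ⟨by norm_num⟩

instance fact_prime_seven : Fact (Nat.Prime 7) := ⟨by norm_num⟩

/-- The linear code `C`, with coordinates indexed by `ι`, is an `[n, k, d]`-code over `F`: it has
length `n`, dimension `k` and minimum Hamming distance exactly `d`. -/
def HasParameters {F ι : Type} [Field F] [DecidableEq F] [Fintype ι]
    (C : Submodule F (ι → F)) (n k d : ℕ) : Prop :=
  Fintype.card ι = n ∧ Module.finrank F C = k ∧
    IsLeast {w : ℕ | ∃ x ∈ C, ∃ y ∈ C, x ≠ y ∧ hammingDist x y = w} d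

/-- The constacyclic shift by `ℓ` positions (meant for `ℓ ≤ n`):
`(c_0, …, c_{n-1}) ↦ (a c_{n-ℓ}, …, a c_{n-1}, c_0, …, c_{n-ℓ-1})`. -/
def constaShift {F : Type} [Field F] {n : ℕ} (ℓ : ℕ) (a : F) (c : Fin n → F) : Fin n → F :=
  fun i =>
    if (i : ℕ) < ℓ then a * c ⟨(i + (n - ℓ)) % n, Nat.mod_lt _ i.pos⟩
    else c ⟨i - ℓ, lt_of_le_of_lt (Nat.sub_le _ _) i.isLt⟩

/-- `C` is a quasi-twisted code of index `ℓ` with shift constant `a`. -/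
def IsQuasiTwisted {F : Type} [Field F] {n : ℕ} (ℓ : ℕ) (a : F)
    (C : Submodule F (Fin n → F)) : Prop :=
  a ≠ 0 ∧ 0 < ℓ ∧ ℓ ∣ n ∧ ∀ c ∈ C, constaShift ℓ a c ∈ C

/-- The `a`-circulant (twistulant) `m × m` matrix with first row `(c_0, …, c_{m-1})`; each row is
the constacyclic shift by one position of the previous row. The subtraction is modulo `m`. -/
def twistulant {F : Type} [Field F] {m : ℕ} (a : F) (c : Fin m → F) : Matrix (Fin m) (Fin m) F :=
  fun i j => if i ≤ j then c (j - i) else a * c (j - i)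

/-- The vector `(c_0, …, c_{m-1})` of the polynomial `c_0 + c_1 x + ⋯` whose coefficients are
listed in `g`, starting with the constant term; missing coefficients are zero. -/
def coeffVec {F : Type} [Field F] (m : ℕ) (g : List F) : Fin m → F :=
  fun j => g.getD j 0

/-- The horizontal join `[G_1 | G_2 | ⋯ | G_ℓ]` of the `a`-circulant matrices of the polynomials
`g_1, …, g_ℓ`; the column `(b, j)` is the column `j` of the block `b`. -/
def blockMatrix {F : Type} [Field F] (m : ℕ) {ℓ : ℕ} (a : F) (g : Fin ℓ → List F) :
    Matrix (Fin m) (Fin ℓ × Fin m) F :=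
  fun i p => twistulant a (coeffVec m (g p.1)) i p.2

/-- The row space of the block matrix `[G_1 | G_2 | ⋯ | G_ℓ]`. -/
def blockCode {F : Type} [Field F] (m : ℕ) {ℓ : ℕ} (a : F) (g : Fin ℓ → List F) :
    Submodule F (Fin ℓ × Fin m → F) :=
  Submodule.span F (Set.range (blockMatrix m a g))

/-- The column permutation between block form and quasi-twisted form: the column `j` of the
block `b` is put at the position `j ℓ + b`. -/
def interleave {F : Type} [Field F] {m ℓ : ℕ} (C : Submodule F (Fin ℓ × Fin m → F)) :
    Submodule F (Fin (m * ℓ) → F) :=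
  C.map (LinearMap.funLeft F F fun s : Fin (m * ℓ) => (s.modNat, s.divNat))

/-- Block polynomials of the code of length 85 over the field with 5 elements. -/
def g85 : Fin 5 → List (ZMod 5) :=
  ![[1,3,3,1,3,1,1,0,0,0,1,0,3,3,3,2],
    [2,0,3,0,1,4,1,0,0,1,2,4,1,4,1,1],
    [3,4,1,2,1,4,3,0,2,2,0,1,3,0,3,1],
    [1,1,2,3,2,0,0,0,1,3,1,3,0,0,1,2],
    [4,2,3,3,0,0,2,1,0,4,3,1,2,0,4,1]]

/-- Block polynomials of the first code of length 84 over the field with 5 elements. -/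
def g84 : Fin 4 → List (ZMod 5) :=
  ![[4,4,0,1,0,3,1,1,0,0,2,3,0,4,1,1,1,2,2,2],
    [1,4,1,0,3,2,0,2,4,2,3,3,4,4,3,2,3,1],
    [1,3,1,0,4,4,3,3,4,4,4,4,2,0,4,4,0,2,0],
    [4,0,1,1,1,1,3,2,2,2,2,4,3,1,2,3,0,1,0]]

/-- Block polynomials of the second code of length 84 over the field with 5 elements. -/
def g84' : Fin 6 → List (ZMod 5) :=
  ![[3,4,0,3,0,0,3,4,4,2,2,4,2,4],
    [4,0,2,3,4,1,4,1,1,1,4,1,4],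
    [1,0,3,4,2,0,2,3,4,0,4,0,3,4],
    [4,4,3,0,0,0,2,4,2,4,1,3,4,4],
    [3,2,2,1,0,3,0,0,3,0,2,1,3],
    [4,3,3,1,1,1,0,4,3,2,0,3]]

/-- Block polynomials of the code of length 65 over the field with 7 elements. -/
def g65 : Fin 5 → List (ZMod 7) :=
  ![[2,3,2,2,6,6,0,2,5,1,5,0,1],
    [4,4,1,5,2,1,5,0,0,4,5,5,6],
    [1,5,5,1,6,2,0,0,1,3,5,5,1],
    [4,0,3,0,0,3,2,1,2,0,6,1,6],
    [4,6,2,6,3,6,4,1,5,0,3,1,1]]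

/-- Block polynomials of the code of length 78 over the field with 7 elements. -/
def g78 : Fin 6 → List (ZMod 7) :=
  ![[6,5,3,6,1,0,6,4,5,0,5,4,6],
    [6,4,0,4,1,0,5,1,5,6,5,1],
    [3,2,2,5,1,0,0,3,5,0,6],
    [5,2,4,2,2,0,2,0,5,5,4,2],
    [5,2,0,3,3,0,3,3,3,4,6,6],
    [1,5,2,1,1,1,1,6,2,4,2]]

end QTCode

/-!
In interleaved order a word consists of `m` columns of `ℓ` symbols, and for the shift constant `1`
the code is invariant under rotations of the columns. By the cycle lemma, a word of weight `w` has a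
rotation whose first `i` columns have weight at most `i w / m` for every `i`. The codes have
systematic generator matrices in interleaved order, so a nonzero word of weight less than `d` would
give one that is determined by a message with light prefixes and first nonzero symbol `1`. These
messages are few enough for an exhaustive search.

The search keeps the weights of many messages in one natural number, in lanes of seven bits. For
every check symbol and every residue `s` there is a number that holds, for every message, the weight
of the check symbol after `s` has been added to it, so that adding one such number per check symbol
updates the weights of all messages at once. All weights start at `64 - d`, and a weight of at least
`d` shows in the highest bit of its lane.
-/

namespace QTCode

/-- The word whose blocks are those of `c` moved cyclically by `r` positions to the left. -/
def rotate {F : Type*} {m ℓ : ℕ} [NeZero m] (r : Fin m) (c : Fin ℓ × Fin m → F) :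
    Fin ℓ × Fin m → F := fun q => c (q.1, q.2 + r)

theorem hammingNorm_rotate {F : Type*} [Zero F] [DecidableEq F] {m ℓ : ℕ} [NeZero m] (r : Fin m)
    (c : Fin ℓ × Fin m → F) : hammingNorm (rotate r c) = hammingNorm c := by
  refine Finset.card_equiv ((Equiv.refl _).prodCongr (Equiv.addRight r)) fun q => ?_
  simp only [Finset.mem_filter_univ]
  rfl

section QuasiTwisted

variable {F : Type} [Field F] {m ℓ : ℕ} [NeZero m]

/-- The constacyclic shift by one position of every block of a word in block form. -/
def blockShift (a : F) : (Fin ℓ × Fin m → F) →ₗ[F] (Fin ℓ × Fin m → F) where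
  toFun c q := if q.2 = 0 then a * c (q.1, q.2 - 1) else c (q.1, q.2 - 1)
  map_add' c c' := by ext q; simp only [Pi.add_apply]; split_ifs <;> ring
  map_smul' u c := by
    ext q
    simp only [Pi.smul_apply, smul_eq_mul, RingHom.id_apply]
    split_ifs <;> ring

theorem blockShift_apply (a : F) (c : Fin ℓ × Fin m → F) (q : Fin ℓ × Fin m) :
    blockShift a c q = if q.2 = 0 then a * c (q.1, q.2 - 1) else c (q.1, q.2 - 1) := rfl

theorem val_sub_one (j : Fin m) : ((j - 1 : Fin m) : ℕ) = if j = 0 then m - 1 else j - 1 := by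
  obtain ⟨m, rfl⟩ := Nat.exists_eq_succ_of_ne_zero (NeZero.ne m)
  rcases Fin.eq_zero_or_eq_succ j with rfl | ⟨j, rfl⟩
  · simp
  · rw [Fin.coe_sub_one, if_neg (Fin.succ_ne_zero j)]
    simp [Fin.succ_ne_zero]

theorem blockShift_blockMatrix (a : F) (g : Fin ℓ → List F) (i : Fin m) :
    blockShift a (blockMatrix m a g (i - 1)) =
      if i = 0 then a • blockMatrix m a g i else blockMatrix m a g i := by
  funext ⟨b, j⟩
  have hi := val_sub_one i
  have hj := val_sub_one j
  have hsub : j - 1 - (i - 1) = j - i := sub_sub_sub_cancel_right j i 1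
  have hle : i - 1 ≤ j - 1 ↔ j = 0 ∨ i ≠ 0 ∧ i ≤ j := by
    have := j.isLt
    have := i.isLt
    simp only [Fin.le_def, hi, hj, ne_eq, Fin.ext_iff, Fin.val_zero]
    split_ifs <;> omega
  simp only [blockShift_apply, blockMatrix, twistulant, hsub, hle]
  by_cases hj0 : j = 0 <;> by_cases hi0 : i = 0 <;>
    simp [hj0, hi0, blockMatrix, twistulant]

theorem blockShift_mem_blockCode {a : F} {g : Fin ℓ → List F} {c : Fin ℓ × Fin m → F}
    (hc : c ∈ blockCode m a g) : blockShift a c ∈ blockCode m a g := by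
  suffices blockCode m a g ≤ (blockCode m a g).comap (blockShift a) from this hc
  refine Submodule.span_le.2 ?_
  rintro _ ⟨i, rfl⟩
  have hrow : blockMatrix m a g (i + 1) ∈ blockCode m a g := Submodule.subset_span ⟨i + 1, rfl⟩
  rw [SetLike.mem_coe, Submodule.mem_comap, ← add_sub_cancel_right i 1, blockShift_blockMatrix]
  split_ifs
  · exact Submodule.smul_mem _ a hrow
  · exact hrow

theorem divNat_eq_zero_iff (hℓ : 0 < ℓ) (s : Fin (m * ℓ)) : s.divNat = 0 ↔ (s : ℕ) < ℓ := by
  rw [Fin.ext_iff, Fin.coe_divNat, Fin.val_zero, Nat.div_eq_zero_iff_lt hℓ]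

theorem constaShift_interleave (hℓ : 0 < ℓ) (a : F) (c : Fin ℓ × Fin m → F) :
    (constaShift ℓ a fun s : Fin (m * ℓ) => c (s.modNat, s.divNat)) =
      fun s => blockShift a c (s.modNat, s.divNat) := by
  funext s
  have := s.isLt
  have hm : m * ℓ = (m - 1) * ℓ + ℓ := by
    rw [← Nat.succ_mul, Nat.succ_eq_add_one, Nat.sub_add_cancel (NeZero.pos m)]
  have hdiv := val_sub_one s.divNat
  simp only [constaShift, blockShift_apply, divNat_eq_zero_iff hℓ] at hdiv ⊢
  split_ifs with h
  · have hlast : ((s : ℕ) + (m * ℓ - ℓ)) % (m * ℓ) = s + (m - 1) * ℓ := by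
      rw [Nat.mod_eq_of_lt] <;> omega
    congr 3 <;> ext
    · simp [hlast]
    · simp [hlast, hdiv, h, Nat.add_mul_div_right _ _ hℓ, Nat.div_eq_of_lt h]
  · congr 2 <;> ext
    · simp [Nat.mod_eq_sub_mod (Nat.le_of_not_lt h)]
    · simp [hdiv, h, Nat.div_eq_sub_div hℓ (Nat.le_of_not_lt h)]

theorem isQuasiTwisted_interleave_blockCode {a : F} (ha : a ≠ 0) (hℓ : 0 < ℓ)
    (g : Fin ℓ → List F) : IsQuasiTwisted ℓ a (interleave (blockCode m a g)) := by
  refine ⟨ha, hℓ, Dvd.intro_left m rfl, ?_⟩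
  rintro _ ⟨c, hc, rfl⟩
  exact ⟨blockShift a c, blockShift_mem_blockCode hc, (constaShift_interleave hℓ a c).symm⟩

theorem rotate_mem_blockCode {g : Fin ℓ → List F} (r : Fin m) {c : Fin ℓ × Fin m → F}
    (hc : c ∈ blockCode m 1 g) : rotate r c ∈ blockCode m 1 g := by
  suffices ∀ t : ℕ, rotate (-Fin.ofNat m t) c ∈ blockCode m 1 g by
    simpa using this ((-r : Fin m) : ℕ)
  intro t
  induction t with
  | zero =>
    convert hc using 1
    funext q
    simp [rotate]
  | succ t ih =>
    convert blockShift_mem_blockCode ih using 1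
    funext q
    have hcast : Fin.ofNat m (t + 1) = Fin.ofNat m t + 1 := by ext; simp [Fin.val_add]
    simp only [rotate, blockShift_apply, one_mul, ite_self]
    rw [hcast, neg_add_rev, ← add_assoc, sub_eq_add_neg]

end QuasiTwisted

theorem periodic_prefix_excess {R : Type*} [CommRing R] {m : ℕ} {f : ℕ → R}
    (hf : Function.Periodic f m) : Function.Periodic
      (fun i : ℕ => m * ∑ s ∈ Finset.range i, f s - i * ∑ s ∈ Finset.range m, f s) m := by
  intro i
  have hshift : ∀ s, f (m + s) = f s := fun s => by rw [add_comm, hf]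
  simp only [add_comm i, Finset.sum_range_add, hshift]
  push_cast
  ring

/-- The rotation starts where the prefix sums exceed the average the most. -/
theorem exists_rotation_prefix_le_average {R : Type*} [CommRing R] [LinearOrder R]
    [IsStrictOrderedRing R] {m : ℕ} (hm : m ≠ 0) {f : ℕ → R} (hf : Function.Periodic f m) :
    ∃ r, ∀ i : ℕ, m * ∑ s ∈ Finset.range i, f (r + s) ≤ i * ∑ s ∈ Finset.range m, f s := by
  obtain ⟨r, -, hmax⟩ := Finset.exists_max_image (Finset.range m)
    (fun i : ℕ => m * ∑ s ∈ Finset.range i, f s - i * ∑ s ∈ Finset.range m, f s)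
    (Finset.nonempty_range_iff.2 hm)
  refine ⟨r, fun i => ?_⟩
  have hle := hmax ((r + i) % m) (Finset.mem_range.2 (Nat.mod_lt _ (Nat.pos_of_ne_zero hm)))
  rw [(periodic_prefix_excess hf).map_mod_nat, Finset.sum_range_add] at hle
  push_cast at hle
  linarith

theorem sum_range_mul {M : Type*} [AddCommMonoid M] (f : ℕ → M) (m ℓ : ℕ) :
    ∑ s ∈ Finset.range (m * ℓ), f s =
      ∑ j ∈ Finset.range m, ∑ b ∈ Finset.range ℓ, f (j * ℓ + b) := by
  induction m with
  | zero => simp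
  | succ m ih => rw [Nat.succ_mul, Finset.sum_range_add, ih, Finset.sum_range_succ]

section Coordinates

variable {F : Type*} {m ℓ : ℕ} [NeZero m] [NeZero ℓ]

/-- The coordinate of a word in block form at the position `s` of the interleaved word, continued
periodically beyond its length `m ℓ`. -/
def coord (c : Fin ℓ × Fin m → F) (s : ℕ) : F := c (Fin.ofNat ℓ s, Fin.ofNat m (s / ℓ))

theorem coord_rotate (r : ℕ) (c : Fin ℓ × Fin m → F) (s : ℕ) :
    coord (rotate (Fin.ofNat m r) c) s = coord c (r * ℓ + s) := by
  simp only [coord, rotate]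
  congr 2 <;> ext
  · simp
  · simp [Fin.val_add, mul_comm r, Nat.mul_add_div (NeZero.pos ℓ), add_comm (s / ℓ)]

theorem coord_add_length (c : Fin ℓ × Fin m → F) (s : ℕ) : coord c (s + m * ℓ) = coord c s := by
  rw [add_comm, ← coord_rotate]
  simp [rotate, coord]

theorem coord_mul_add (c : Fin ℓ × Fin m → F) (b : Fin ℓ) (j : Fin m) :
    coord c (j * ℓ + b) = c (b, j) := by
  simp only [coord]
  congr 2 <;> ext
  · simp [Nat.mod_eq_of_lt b.isLt]
  · simp [mul_comm, Nat.mul_add_div (NeZero.pos ℓ), Nat.div_eq_of_lt b.isLt]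

variable [Zero F]

theorem eq_zero_of_coord_eq_zero {c : Fin ℓ × Fin m → F} (h : ∀ s < m * ℓ, coord c s = 0) :
    c = 0 := by
  funext ⟨b, j⟩
  rw [← coord_mul_add c b j, h _ ?_]
  · rfl
  · calc (j : ℕ) * ℓ + b < j * ℓ + ℓ := by omega
      _ = (j + 1) * ℓ := by ring
      _ ≤ m * ℓ := Nat.mul_le_mul_right _ j.isLt

variable [DecidableEq F]

/-- The number of nonzero symbols at the positions `s, …, s + n - 1` of the interleaved word. -/
def windowWeight (c : Fin ℓ × Fin m → F) (s n : ℕ) : ℕ :=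
  ∑ t ∈ Finset.range n, if coord c (s + t) = 0 then 0 else 1

theorem windowWeight_add (c : Fin ℓ × Fin m → F) (s n n' : ℕ) :
    windowWeight c s (n + n') = windowWeight c s n + windowWeight c (s + n) n' := by
  simp only [windowWeight, Finset.sum_range_add, add_assoc]

theorem windowWeight_mono (c : Fin ℓ × Fin m → F) (s : ℕ) : Monotone (windowWeight c s) :=
  fun _ _ h => Finset.sum_le_sum_of_subset (Finset.range_subset_range.2 h)

theorem hammingNorm_eq_windowWeight (c : Fin ℓ × Fin m → F) :
    hammingNorm c = windowWeight c 0 (m * ℓ) := by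
  rw [windowWeight, sum_range_mul, hammingNorm, Finset.card_filter, Fintype.sum_prod_type_right]
  simp only [zero_add, Finset.sum_range, coord_mul_add, ne_eq, ite_not]

theorem exists_rotate_windowWeight_le (c : Fin ℓ × Fin m → F) :
    ∃ r : Fin m, ∀ i, m * windowWeight (rotate r c) 0 (i * ℓ) ≤ i * hammingNorm c := by
  have hper : Function.Periodic (fun j => (windowWeight c (j * ℓ) ℓ : ℤ)) m := fun j => by
    simp only [windowWeight, add_mul, add_right_comm _ (m * ℓ), coord_add_length]
  obtain ⟨r, hr⟩ := exists_rotation_prefix_le_average (NeZero.ne m) hper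
  refine ⟨Fin.ofNat m r, fun i => ?_⟩
  rw [hammingNorm_eq_windowWeight]
  simp only [windowWeight, coord_rotate, sum_range_mul, zero_add]
  simpa only [windowWeight, add_mul, add_assoc, ← Nat.cast_sum, ← Nat.cast_mul, Nat.cast_le]
    using hr i

end Coordinates

theorem hasParameters_of_hammingNorm {F ι : Type} [Field F] [DecidableEq F] [Fintype ι]
    {C : Submodule F (ι → F)} {n k d : ℕ} (hn : Fintype.card ι = n)
    (hk : Module.finrank F C = k) (hle : ∀ c ∈ C, c ≠ 0 → d ≤ hammingNorm c)
    (hmem : ∃ c ∈ C, c ≠ 0 ∧ hammingNorm c = d) : HasParameters C n k d := by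
  refine ⟨hn, hk, ?_, ?_⟩
  · obtain ⟨c, hc, hc0, hd⟩ := hmem
    exact ⟨c, hc, 0, C.zero_mem, hc0, by rw [hammingDist_zero_right, hd]⟩
  · rintro _ ⟨x, hx, y, hy, hxy, rfl⟩
    rw [hammingDist_comm, hammingDist_eq_hammingNorm, neg_add_eq_sub]
    exact hle _ (C.sub_mem hx hy) (sub_ne_zero.2 hxy)

section Systematic

variable {F : Type} [Field F] {m ℓ : ℕ} [NeZero m] [NeZero ℓ]

/-- In interleaved order, the first `k` symbols of a word of `C` are arbitrary and the others are
the linear combinations of them whose coefficients are the columns of `A`. -/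
structure IsSystematic (C : Submodule F (Fin ℓ × Fin m → F)) (k : ℕ) (A : ℕ → ℕ → F) : Prop where
  le_length : k ≤ m * ℓ
  exists_coord_eq : ∀ x : ℕ → F, ∃ c ∈ C, ∀ i < k, coord c i = x i
  coord_add : ∀ c ∈ C, ∀ t < m * ℓ - k,
    coord c (k + t) = ∑ i ∈ Finset.range k, coord c i * A i t

namespace IsSystematic

variable {C : Submodule F (Fin ℓ × Fin m → F)} {k : ℕ} {A : ℕ → ℕ → F}

theorem eq_zero (hC : IsSystematic C k A) {c : Fin ℓ × Fin m → F} (hc : c ∈ C)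
    (h : ∀ i < k, coord c i = 0) : c = 0 := by
  refine eq_zero_of_coord_eq_zero fun s hs => ?_
  rcases lt_or_ge s k with hsk | hsk
  · exact h s hsk
  · obtain ⟨t, rfl⟩ := Nat.exists_eq_add_of_le hsk
    rw [hC.coord_add c hc t (by omega)]
    exact Finset.sum_eq_zero fun i hi => by rw [h i (Finset.mem_range.1 hi), zero_mul]

theorem finrank_eq (hC : IsSystematic C k A) : Module.finrank F C = k := by
  let message : (Fin ℓ × Fin m → F) →ₗ[F] (Fin k → F) :=
    LinearMap.funLeft F F fun i => (Fin.ofNat ℓ i, Fin.ofNat m (i / ℓ))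
  have hmessage : ∀ c i, message c i = coord c i := fun _ _ => rfl
  have hbij : Function.Bijective (message.domRestrict C) := by
    constructor
    · rw [injective_iff_map_eq_zero]
      rintro ⟨c, hc⟩ h0
      simpa using hC.eq_zero hc fun i hi => congrFun h0 ⟨i, hi⟩
    · intro y
      obtain ⟨c, hc, hy⟩ := hC.exists_coord_eq fun i => if hi : i < k then y ⟨i, hi⟩ else 0
      refine ⟨⟨c, hc⟩, funext fun i => ?_⟩
      rw [LinearMap.domRestrict_apply, hmessage, hy i i.isLt, dif_pos i.isLt]
  rw [(LinearEquiv.ofBijective _ hbij).finrank_eq, Module.finrank_fin_fun]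

theorem exists_first_coord_ne_zero (hC : IsSystematic C k A) {c : Fin ℓ × Fin m → F} (hc : c ∈ C)
    (h0 : c ≠ 0) : ∃ f < k, coord c f ≠ 0 ∧ ∀ s < f, coord c s = 0 := by
  classical
  have hex : ∃ s, s < k ∧ coord c s ≠ 0 := by
    by_contra! h
    exact h0 (hC.eq_zero hc h)
  obtain ⟨hk, hne⟩ := Nat.find_spec hex
  refine ⟨Nat.find hex, hk, hne, fun s hs => ?_⟩
  by_contra hs0
  exact Nat.find_min hex hs ⟨hs.trans hk, hs0⟩

variable [DecidableEq F]

/-- After a rotation and a scaling, a word of a code invariant under rotations has light prefixes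
and first nonzero symbol `1`, so an exhaustive search may be restricted to such words. -/
theorem exists_normalized (hC : IsSystematic C k A) (hrot : ∀ r, ∀ c ∈ C, rotate r c ∈ C)
    {c : Fin ℓ × Fin m → F} (hc : c ∈ C) (h0 : c ≠ 0) :
    ∃ c' ∈ C, hammingNorm c' = hammingNorm c ∧
      (∀ i, m * windowWeight c' 0 (i * ℓ) ≤ i * hammingNorm c) ∧
      ∃ f < k, coord c' f = 1 ∧ ∀ s < f, coord c' s = 0 := by
  obtain ⟨r, hr⟩ := exists_rotate_windowWeight_le c
  have hne : rotate r c ≠ 0 := by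
    rwa [← hammingNorm_ne_zero_iff, hammingNorm_rotate, hammingNorm_ne_zero_iff]
  obtain ⟨f, hf, hf0, hlt⟩ := hC.exists_first_coord_ne_zero (hrot r c hc) hne
  have hu : (coord (rotate r c) f)⁻¹ ≠ 0 := inv_ne_zero hf0
  have hcoord : ∀ s, coord ((coord (rotate r c) f)⁻¹ • rotate r c) s =
    (coord (rotate r c) f)⁻¹ * coord (rotate r c) s := fun s => rfl
  refine ⟨_, C.smul_mem (coord (rotate r c) f)⁻¹ (hrot r c hc), ?_, fun i => ?_, f, hf, ?_, ?_⟩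
  · rw [hammingNorm_smul (fun _ _ _ h => mul_left_cancel₀ hu h), hammingNorm_rotate]
  · simpa only [windowWeight, hcoord, mul_eq_zero, hu, false_or] using hr i
  · rw [hcoord, inv_mul_cancel₀ hf0]
  · intro s hs
    rw [hcoord, hlt s hs, mul_zero]

end IsSystematic

end Systematic

/-- The entries of a matrix given by its list of rows, with zeros outside the lists. -/
def entry (A : List (List ℕ)) (i j : ℕ) : ℕ := (A.getD i []).getD j 0

/-- The number of nonzero symbols of a list of symbols. -/
def weight (v : List ℕ) : ℕ := v.countP (· ≠ 0)

/-- The component at `j` of the vector `v` times the matrix with the rows `A`, as a natural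
number. -/
def dot (v : List ℕ) (A : List (List ℕ)) (j : ℕ) : ℕ :=
  (List.zipWith (fun x row => x * row.getD j 0) v A).sum

theorem eq_map_getD {α : Type*} {l : List α} {n : ℕ} (hl : l.length = n) (d : α) :
    l = (List.range n).map fun i => l.getD i d :=
  List.ext_getElem (by simp [hl]) fun i hi _ => by simp [hi]

theorem getD_lt {l : List ℕ} {b : ℕ} (hb : 0 < b) (hl : ∀ x ∈ l, x < b) (i : ℕ) :
    l.getD i 0 < b := by
  rcases lt_or_ge i l.length with hi | hi
  · rw [List.getD_eq_getElem _ _ hi]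
    exact hl _ (List.getElem_mem hi)
  · rwa [List.getD_eq_default _ _ hi]

theorem dot_cons (x : ℕ) (v : List ℕ) (row : List ℕ) (A : List (List ℕ)) (j : ℕ) :
    dot (x :: v) (row :: A) j = x * row.getD j 0 + dot v A j := by
  rw [dot, List.zipWith_cons_cons, List.sum_cons, dot]

theorem dot_map_range {k : ℕ} (x : ℕ → ℕ) {A : List (List ℕ)} (hA : A.length = k) (j : ℕ) :
    dot ((List.range k).map x) A j = ∑ i ∈ Finset.range k, x i * entry A i j := by
  conv_lhs => rw [eq_map_getD hA [], dot, List.zipWith_map, List.zipWith_self]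
  rfl

theorem weight_zero_cons (v : List ℕ) : weight (0 :: v) = weight v := rfl

theorem weight_succ_cons (x : ℕ) (v : List ℕ) : weight ((x + 1) :: v) = weight v + 1 :=
  List.countP_cons_of_pos (by simp)

theorem weight_map_range (x : ℕ → ℕ) (k : ℕ) :
    weight ((List.range k).map x) = ∑ i ∈ Finset.range k, if x i = 0 then 0 else 1 := by
  induction k with
  | zero => rfl
  | succ k ih =>
    rw [List.range_succ, Finset.sum_range_succ, ← ih, weight, weight, List.map_append,
      List.countP_append]
    by_cases h : x k = 0 <;> simp [h]

/-- Whether a symbol modulo `p` is nonzero, as a number. -/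
def symbolWeight (p x : ℕ) : ℕ := if x % p = 0 then 0 else 1

section Certificates

variable {p m ℓ : ℕ} [Fact p.Prime] [NeZero m] [NeZero ℓ]

/-- The entry of the row `i` of the block matrix with shift constant `1` at the position `s` in
interleaved order, as a number. -/
def digit (m : ℕ) (g : Fin ℓ → List (ZMod p)) (i s : ℕ) : ℕ :=
  ((g (Fin.ofNat ℓ s)).getD ((m - i + s / ℓ) % m) 0).val

/-- Whether in every row of the block matrix the symbols from `k` on are the combination of the
rows `A` given by the first `k` symbols. -/
def checkSystematic (m : ℕ) (g : Fin ℓ → List (ZMod p)) (k : ℕ) (A : List (List ℕ)) : Bool :=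
  (List.range m).all fun i => (List.range (m * ℓ - k)).all fun t =>
    Nat.beq (dot ((List.range k).map (digit m g i)) A t % p) (digit m g i (k + t))

/-- Whether the rows of `B` are the coefficients of combinations of the first `k` rows of the block
matrix that start with the unit vectors of length `k`. -/
def checkInverse (m : ℕ) (g : Fin ℓ → List (ZMod p)) (k : ℕ) (B : List (List ℕ)) : Bool :=
  (List.range k).all fun i => (List.range k).all fun j =>
    Nat.beq (dot ((List.range k).map (entry B i))
      ((List.range k).map fun r => (List.range k).map (digit m g r)) j % p) (if i = j then 1 else 0)

theorem coord_blockMatrix (g : Fin ℓ → List (ZMod p)) (i : Fin m) (s : ℕ) :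
    coord (blockMatrix m 1 g i) s = (digit m g i s : ZMod p) := by
  simp only [coord, blockMatrix, twistulant, one_mul, ite_self, digit, ZMod.natCast_zmod_val,
    coeffVec]
  simp [Fin.sub_def]

theorem coord_sum {ι : Type*} (I : Finset ι) (c : ι → Fin ℓ × Fin m → ZMod p) (s : ℕ) :
    coord (∑ i ∈ I, c i) s = ∑ i ∈ I, coord (c i) s :=
  Finset.sum_apply _ I c

theorem coord_add_of_checkSystematic {g : Fin ℓ → List (ZMod p)} {k : ℕ} {A : List (List ℕ)}
    (hA : A.length = k) (h : checkSystematic m g k A = true) {c : Fin ℓ × Fin m → ZMod p}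
    (hc : c ∈ blockCode m 1 g) {t : ℕ} (ht : t < m * ℓ - k) :
    coord c (k + t) = ∑ i ∈ Finset.range k, coord c i * (entry A i t : ZMod p) := by
  have hcoord_add (c c' : Fin ℓ × Fin m → ZMod p) (s : ℕ) :
    coord (c + c') s = coord c s + coord c' s := rfl
  have hcoord_smul (u : ZMod p) (c : Fin ℓ × Fin m → ZMod p) (s : ℕ) :
    coord (u • c) s = u * coord c s := rfl
  induction hc using Submodule.span_induction with
  | mem c hc =>
    obtain ⟨i, rfl⟩ := hc
    have hrow := List.all_eq_true.1 (List.all_eq_true.1 h i (by simp)) t (by simpa using ht)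
    rw [coord_blockMatrix, ← Nat.eq_of_beq_eq_true hrow, ZMod.natCast_mod, dot_map_range _ hA]
    push_cast
    simp only [coord_blockMatrix]
  | zero => simp [coord]
  | add c c' _ _ hc hc' => simp only [hcoord_add, hc, hc', add_mul, Finset.sum_add_distrib]
  | smul u c _ hc => simp only [hcoord_smul, hc, Finset.mul_sum, mul_assoc]

theorem exists_coord_eq_of_checkInverse {g : Fin ℓ → List (ZMod p)} {k : ℕ} {B : List (List ℕ)}
    (hk : k ≤ m) (h : checkInverse m g k B = true) (x : ℕ → ZMod p) :
    ∃ c ∈ blockCode m 1 g, ∀ j < k, coord c j = x j := by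
  have hmem : ∀ i : ℕ, blockMatrix m 1 g (Fin.ofNat m i) ∈ blockCode m 1 g :=
    fun i => Submodule.subset_span ⟨_, rfl⟩
  let e (i : ℕ) : Fin ℓ × Fin m → ZMod p :=
    ∑ r ∈ Finset.range k, (entry B i r : ZMod p) • blockMatrix m 1 g (Fin.ofNat m r)
  have he : ∀ i < k, ∀ j < k, coord (e i) j = if i = j then 1 else 0 := by
    intro i hi j hj
    have hunit := List.all_eq_true.1
      (List.all_eq_true.1 h i (List.mem_range.2 hi)) j (List.mem_range.2 hj)
    have hcast := congrArg (Nat.cast : ℕ → ZMod p) (Nat.eq_of_beq_eq_true hunit)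
    rw [ZMod.natCast_mod, dot_map_range _ (by simp)] at hcast
    push_cast at hcast
    rw [← hcast, coord_sum]
    refine Finset.sum_congr rfl fun r hr => ?_
    have hr : r < k := Finset.mem_range.1 hr
    change (entry B i r : ZMod p) * coord (blockMatrix m 1 g (Fin.ofNat m r)) j = _
    rw [coord_blockMatrix]
    simp [entry, hr, hj, Nat.mod_eq_of_lt (hr.trans_le hk)]
  refine ⟨∑ i ∈ Finset.range k, x i • e i, ?_, fun j hj => ?_⟩
  · exact Submodule.sum_mem _ fun i _ => Submodule.smul_mem _ _ (Submodule.sum_mem _ fun r _ =>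
      Submodule.smul_mem _ _ (hmem r))
  · rw [coord_sum]
    calc ∑ i ∈ Finset.range k, coord (x i • e i) j
        = ∑ i ∈ Finset.range k, x i * if i = j then 1 else 0 :=
          Finset.sum_congr rfl fun i hi => congrArg (x i * ·) (he i (Finset.mem_range.1 hi) j hj)
      _ = x j := by simp [hj]

theorem isSystematic_of_check {g : Fin ℓ → List (ZMod p)} {k : ℕ} {A B : List (List ℕ)}
    (hk : k ≤ m) (hA : A.length = k) (hsys : checkSystematic m g k A = true)
    (hinv : checkInverse m g k B = true) :
    IsSystematic (blockCode m 1 g) k fun i t => (entry A i t : ZMod p) where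
  le_length := hk.trans (Nat.le_mul_of_pos_right _ (NeZero.pos ℓ))
  exists_coord_eq := exists_coord_eq_of_checkInverse hk hinv
  coord_add _ hc _ ht := coord_add_of_checkSystematic hA hsys hc ht

end Certificates

section Messages

variable {p m ℓ : ℕ} [Fact p.Prime] [NeZero m] [NeZero ℓ]

/-- The first `k` symbols of a word in interleaved order, as numbers. -/
def message (k : ℕ) (c : Fin ℓ × Fin m → ZMod p) : List ℕ :=
  (List.range k).map fun s => (coord c s).val

/-- The weight of the word that consists of the message `v` and of the `n` check symbols computed
from it with the rows `A`, when the numbers `D` are added to the check symbols. -/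
def encodedWeight (p n : ℕ) (A : List (List ℕ)) (D : ℕ → ℕ) (v : List ℕ) : ℕ :=
  weight v + ∑ j ∈ Finset.range n, symbolWeight p (D j + dot v A j)

/-- The messages whose prefixes, with `a` added to their weights, have weights bounded by the list
of caps; the caps are tested at the nonzero symbols only. -/
def messages (p : ℕ) : List ℕ → ℕ → List (List ℕ)
  | [], _ => [[]]
  | cap :: caps, a =>
    (messages p caps a).map (0 :: ·) ++
      if a < cap then
        (List.range (p - 1)).flatMap fun x => (messages p caps (a + 1)).map ((x + 1) :: ·)
      else []

/-- Bounds on the weights of the nonempty prefixes of the message of a word of weight less than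
`d` whose first `i` columns have weight at most `i / m` times the weight of the word. -/
def weightCaps (m ℓ k d : ℕ) : List ℕ := (List.range k).map fun s => (s / ℓ + 1) * (d - 1) / m

theorem mem_messages_cons {q cap : ℕ} {caps : List ℕ} {a : ℕ} {v : List ℕ} :
    v ∈ messages q (cap :: caps) a ↔ (∃ v' ∈ messages q caps a, 0 :: v' = v) ∨
      a < cap ∧ ∃ x < q - 1, ∃ v' ∈ messages q caps (a + 1), (x + 1) :: v' = v := by
  rw [messages, List.mem_append, List.mem_map]
  split_ifs with ha <;> simp [ha]

theorem length_of_mem_messages {q : ℕ} {caps : List ℕ} {a : ℕ} {v : List ℕ}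
    (hv : v ∈ messages q caps a) : v.length = caps.length := by
  induction caps generalizing a v with
  | nil => simp_all [messages]
  | cons cap caps ih =>
    obtain ⟨v', hv', rfl⟩ | ⟨-, x, -, v', hv', rfl⟩ := mem_messages_cons.1 hv
    all_goals rw [List.length_cons, List.length_cons, ih hv']

theorem map_mem_messages {q : ℕ} {x cap : ℕ → ℕ} {n s a : ℕ} (hx : ∀ i, x i < q)
    (h : ∀ i < n, a + ∑ t ∈ Finset.range (i + 1), (if x (s + t) = 0 then 0 else 1) ≤ cap (s + i)) :
    (List.range' s n).map x ∈ messages q ((List.range' s n).map cap) a := by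
  induction n generalizing s a with
  | zero => simp [messages]
  | succ n ih =>
    have htail : ∀ i < n, a + (if x s = 0 then 0 else 1) +
        ∑ t ∈ Finset.range (i + 1), (if x (s + 1 + t) = 0 then 0 else 1) ≤ cap (s + 1 + i) := by
      intro i hi
      have hi := h (i + 1) (by omega)
      rw [Finset.sum_range_succ', add_zero, add_comm (∑ _ ∈ _, _), ← add_assoc] at hi
      simpa only [add_assoc, add_comm 1] using hi
    rw [List.range'_succ, List.map_cons, List.map_cons, mem_messages_cons]
    by_cases h0 : x s = 0
    · rw [if_pos h0] at htail
      exact .inl ⟨_, ih htail, by rw [h0]⟩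
    · rw [if_neg h0] at htail
      have hhead := h 0 (by omega)
      simp only [zero_add, Finset.sum_range_one, add_zero, if_neg h0] at hhead
      exact .inr ⟨hhead, x s - 1, by have := hx s; omega, _, ih htail, by congr 1; omega⟩

theorem weight_message (k : ℕ) (c : Fin ℓ × Fin m → ZMod p) :
    weight (message k c) = windowWeight c 0 k := by
  simp only [message, weight_map_range, windowWeight, ZMod.val_eq_zero, zero_add]

theorem coord_eq_dot_message {C : Submodule (ZMod p) (Fin ℓ × Fin m → ZMod p)} {k : ℕ}
    {A : List (List ℕ)} (hA : A.length = k)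
    (hC : IsSystematic C k fun i t => (entry A i t : ZMod p)) {c : Fin ℓ × Fin m → ZMod p}
    (hc : c ∈ C) {t : ℕ} (ht : t < m * ℓ - k) : coord c (k + t) = dot (message k c) A t := by
  rw [hC.coord_add c hc t ht, message, dot_map_range _ hA]
  simp

theorem hammingNorm_eq_encodedWeight {C : Submodule (ZMod p) (Fin ℓ × Fin m → ZMod p)} {k : ℕ}
    {A : List (List ℕ)} (hA : A.length = k)
    (hC : IsSystematic C k fun i t => (entry A i t : ZMod p)) {c : Fin ℓ × Fin m → ZMod p}
    (hc : c ∈ C) : hammingNorm c = encodedWeight p (m * ℓ - k) A 0 (message k c) := by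
  calc hammingNorm c
      = windowWeight c 0 k + windowWeight c k (m * ℓ - k) := by
        rw [hammingNorm_eq_windowWeight, ← Nat.add_sub_cancel' hC.le_length, windowWeight_add,
          zero_add, Nat.add_sub_cancel_left]
    _ = encodedWeight p (m * ℓ - k) A 0 (message k c) := by
        rw [encodedWeight, weight_message, windowWeight]
        refine congrArg _ (Finset.sum_congr rfl fun t ht => ?_)
        simp only [coord_eq_dot_message hA hC hc (Finset.mem_range.1 ht), symbolWeight,
          ZMod.natCast_eq_zero_iff, Nat.dvd_iff_mod_eq_zero,
          Pi.zero_apply, zero_add]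

theorem message_mem_messages {k d : ℕ} {c : Fin ℓ × Fin m → ZMod p}
    (h : ∀ i, m * windowWeight c 0 (i * ℓ) ≤ i * (d - 1)) :
    message k c ∈ messages p (weightCaps m ℓ k d) 0 := by
  rw [message, weightCaps, List.range_eq_range']
  refine map_mem_messages (fun s => ZMod.val_lt _) fun i _ => ?_
  rw [Nat.le_div_iff_mul_le (NeZero.pos m), zero_add, zero_add, mul_comm _ m]
  refine le_trans (Nat.mul_le_mul_left _ ?_) (h (i / ℓ + 1))
  simp only [ZMod.val_eq_zero]
  refine windowWeight_mono c 0 ?_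
  rw [mul_comm]
  exact Nat.lt_mul_div_succ i (NeZero.pos ℓ)

theorem find?_message {k f : ℕ} {c : Fin ℓ × Fin m → ZMod p} (hf : f < k) (hone : coord c f = 1)
    (hzero : ∀ s < f, coord c s = 0) : (message k c).find? (· ≠ 0) = some 1 := by
  have : Fact (1 < p) := ⟨(Fact.out : p.Prime).one_lt⟩
  have hfirst : (List.range k).find? ((fun x : ℕ => decide (x ≠ 0)) ∘ fun s => (coord c s).val) =
      some f := by
    rw [List.find?_range_eq_some]
    exact ⟨by simp [hone], by simpa using hf, fun t ht => by simp [hzero t ht]⟩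
  rw [message, List.find?_map, hfirst, Option.map_some, hone, ZMod.val_one]

end Messages

section Lanes

/-- The list `l` packed into one number with `7` bits for every entry. -/
def lanes (l : List ℕ) : ℕ := Nat.ofDigits 128 l

/-- The number that continues the `w` low bits `x` with the bits of `y`. -/
def join (w x y : ℕ) : ℕ := x + y <<< w

/-- The packed list that consists of `n` copies of the packed list `x` of `w` bits. -/
def repeatLanes (w x : ℕ) : ℕ → ℕ
  | 0 => 0
  | n + 1 => join w x (repeatLanes w x n)

theorem lanes_append (l l' : List ℕ) :
    lanes (l ++ l') = join (7 * l.length) (lanes l) (lanes l') := by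
  rw [lanes, lanes, lanes, join, Nat.ofDigits_append, Nat.shiftLeft_eq, pow_mul, mul_comm _ (_ ^ _)]
  rfl

theorem repeatLanes_lanes (l : List ℕ) (n : ℕ) :
    repeatLanes (7 * l.length) (lanes l) n = lanes ((List.range n).flatMap fun _ => l) := by
  induction n with
  | zero => rfl
  | succ n ih =>
    rw [repeatLanes, ih, ← lanes_append, List.range_succ_eq_map, List.flatMap_cons,
      List.flatMap_map]

theorem ofDigits_map_add_mul {α : Type*} (B x : ℕ) (f g : α → ℕ) (l : List α) :
    Nat.ofDigits B (l.map fun i => f i + x * g i) =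
      Nat.ofDigits B (l.map f) + x * Nat.ofDigits B (l.map g) := by
  induction l with
  | nil => rfl
  | cons i l ih =>
    simp only [List.map_cons, Nat.ofDigits_cons, ih]
    ring

theorem lanes_map_add_sum {α β : Type*} (L : List α) (f : α → ℕ) (l : List β) (g : β → α → ℕ) :
    lanes (L.map f) + (l.map fun j => lanes (L.map (g j))).sum =
      lanes (L.map fun v => f v + (l.map fun j => g j v).sum) := by
  induction l generalizing f with
  | nil => simp
  | cons j l ih =>
    have hadd : lanes (L.map f) + lanes (L.map (g j)) = lanes (L.map fun v => f v + g j v) := by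
      simpa only [lanes, one_mul] using (ofDigits_map_add_mul 128 1 f (g j) L).symm
    simp only [List.map_cons, List.sum_cons]
    rw [← add_assoc, hadd, ih]
    simp only [add_assoc]

/-- The bit of value `64` is the highest bit of a lane. -/
theorem le_of_land_lanes {l : List ℕ} (hlt : ∀ x ∈ l, x < 128)
    (h : lanes l &&& 64 * lanes (l.map fun _ => 1) = 64 * lanes (l.map fun _ => 1)) :
    ∀ x ∈ l, 64 ≤ x := by
  induction l with
  | nil => simp
  | cons x l ih =>
    have hx : x < 2 ^ 7 := hlt x List.mem_cons_self
    have hones : 64 * lanes ((x :: l).map fun _ => 1) =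
        64 + 2 ^ 7 * (64 * lanes (l.map fun _ => 1)) := by
      simp only [lanes, List.map_cons, Nat.ofDigits_cons]
      ring
    have hlanes : lanes (x :: l) = x + 2 ^ 7 * lanes l := Nat.ofDigits_cons
    rw [hones, hlanes] at h
    have hlow : (_ &&& _) % 2 ^ 7 = _ % 2 ^ 7 := congrArg (· % 2 ^ 7) h
    have hhigh : (_ &&& _) / 2 ^ 7 = _ / 2 ^ 7 := congrArg (· / 2 ^ 7) h
    rw [Nat.and_mod_two_pow, Nat.add_mul_mod_self_left, Nat.add_mul_mod_self_left,
      Nat.mod_eq_of_lt hx] at hlow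
    rw [Nat.and_div_two_pow, Nat.add_mul_div_left _ _ (Nat.two_pow_pos 7),
      Nat.add_mul_div_left _ _ (Nat.two_pow_pos 7), Nat.div_eq_of_lt hx, zero_add,
      Nat.div_eq_of_lt (by norm_num), zero_add] at hhigh
    have hxle : 64 ≤ x := Nat.and_le_left.trans_eq' hlow
    exact List.forall_mem_cons.2
      ⟨hxle, ih (fun y hy => hlt y (List.mem_cons_of_mem _ hy)) hhigh⟩

end Lanes

section ListRecursors

/-!
The kernel evaluates applications of recursors to lists faster than the library functions that
they compute, which are defined by structural recursion.
-/

/-- The function `List.zipWith (join w)`. -/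
def zipJoin (w : ℕ) (l : List ℕ) : List ℕ → List ℕ :=
  List.rec (fun _ => []) (fun x _ ih l₂ => List.rec [] (fun y ys _ => join w x y :: ih ys) l₂) l

/-- The function `List.append`. -/
def append (l l' : List ℕ) : List ℕ := List.rec l' (fun x _ ih => x :: ih) l

/-- The function `List.drop`. -/
def drop (r : ℕ) : List ℕ → List ℕ :=
  Nat.rec (fun l => l) (fun _ ih l => List.rec [] (fun _ xs _ => ih xs) l) r

/-- The function `fun i => t.getD i 0`. -/
def lookup (t : List ℕ) : ℕ → ℕ :=
  List.rec (fun _ => 0) (fun x _ ih i => Nat.rec x (fun j _ => ih j) i) t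

/-- The value `f i`, computed by the kernel after the value of `i`. -/
def onValue (f : ℕ → ℕ) (i : ℕ) : ℕ := Nat.rec (f 0) (fun j _ => f (j + 1)) i

theorem zipJoin_eq (w : ℕ) (l l' : List ℕ) : zipJoin w l l' = List.zipWith (join w) l l' := by
  induction l generalizing l' with
  | nil => rfl
  | cons x l ih =>
    cases l' with
    | nil => rfl
    | cons y l' => exact congrArg (join w x y :: ·) (ih l')

theorem append_eq (l l' : List ℕ) : append l l' = l ++ l' := by
  induction l with
  | nil => rfl
  | cons x l ih => exact congrArg (x :: ·) ih

theorem drop_eq (r : ℕ) (l : List ℕ) : drop r l = l.drop r := by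
  induction r generalizing l with
  | zero => rfl
  | succ r ih =>
    cases l with
    | nil => rfl
    | cons x l => exact ih l

theorem lookup_eq (t : List ℕ) (i : ℕ) : lookup t i = t.getD i 0 := by
  induction t generalizing i with
  | nil => rfl
  | cons x t ih =>
    cases i with
    | zero => rfl
    | succ i => exact ih i

theorem onValue_eq (f : ℕ → ℕ) (i : ℕ) : onValue f i = f i := by cases i <;> rfl

end ListRecursors

section Columns

/-- The list `f` from its entry `r` on, followed by a further copy of `f`. -/
def dropFromTwo (r : ℕ) (f : List ℕ) : List ℕ := drop r (append f f)

/-- The lanes `t s` followed by the lanes `u (s + r)`, …, `u (s + (p - 1) r)`, for every `s`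
modulo `p`; the lanes in `t` have `w` bits in total, those in `u` have `w'` bits. -/
def mergeColumn (p w w' r : ℕ) (t u : List ℕ) : List ℕ :=
  zipJoin w t (dropFromTwo r ((fun f => zipJoin w' u (dropFromTwo r f))^[p - 2] u))

/-- The result of `mergeColumn` for every entry of `row`. -/
def mergeColumns (p w w' : ℕ) : List ℕ → List (List ℕ) → List (List ℕ) → List (List ℕ)
  | r :: row, t :: ts, t' :: ts' => mergeColumn p w w' r t t' :: mergeColumns p w w' row ts ts'
  | _, _, _ => []

variable {p r w w' : ℕ} {A B : ℕ → List ℕ}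

theorem zipJoin_dropFromTwo (hA : ∀ s, 7 * (A s).length = w) (hB : Function.Periodic B p)
    (hr : r ≤ p) : zipJoin w ((List.range p).map fun s => lanes (A s))
        (dropFromTwo r ((List.range p).map fun s => lanes (B s))) =
      (List.range p).map fun s => lanes (A s ++ B (s + r)) := by
  rw [zipJoin_eq, dropFromTwo, append_eq, drop_eq]
  refine List.ext_getElem (by simp; omega) fun s _ hs => ?_
  have : s < p := by simpa using hs
  have hdrop : ∀ h, (((List.range p).map fun s => lanes (B s)) ++
      (List.range p).map fun s => lanes (B s))[r + s]'h = lanes (B (s + r)) := by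
    intro h
    rw [List.getElem_append]
    split_ifs with hlt
    · simp [add_comm]
    · simp only [List.length_map, List.length_range, List.getElem_map, List.getElem_range] at hlt ⊢
      rw [← hB, Nat.sub_add_cancel (by omega), add_comm]
  rw [List.getElem_zipWith, List.getElem_drop, hdrop, List.getElem_map, List.getElem_map,
    List.getElem_range, lanes_append, hA]

theorem iterate_zipJoin_dropFromTwo (hB : ∀ s, 7 * (B s).length = w')
    (hper : Function.Periodic B p) (hr : r ≤ p) (q : ℕ) :
    (fun f => zipJoin w' ((List.range p).map fun s => lanes (B s)) (dropFromTwo r f))^[q]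
        ((List.range p).map fun s => lanes (B s)) =
      (List.range p).map fun s => lanes ((List.range (q + 1)).flatMap fun x => B (s + x * r)) := by
  induction q with
  | zero => simp
  | succ q ih =>
    rw [Function.iterate_succ_apply', ih, zipJoin_dropFromTwo hB _ hr]
    · refine List.map_congr_left fun s _ => ?_
      rw [List.range_succ_eq_map (n := q + 1), List.flatMap_cons, List.flatMap_map]
      simp only [zero_mul, add_zero, add_assoc, Nat.succ_mul, add_comm r]
    · intro s
      simp only [add_right_comm s p, hper _]

theorem mergeColumn_map_lanes (hp : 2 ≤ p) (hA : ∀ s, 7 * (A s).length = w)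
    (hB : ∀ s, 7 * (B s).length = w') (hper : Function.Periodic B p) (hr : r ≤ p) :
    mergeColumn p w w' r ((List.range p).map fun s => lanes (A s))
        ((List.range p).map fun s => lanes (B s)) =
      (List.range p).map fun s =>
        lanes (A s ++ (List.range (p - 1)).flatMap fun x => B (s + (x + 1) * r)) := by
  rw [mergeColumn, iterate_zipJoin_dropFromTwo hB hper hr, zipJoin_dropFromTwo hA _ hr,
    show p - 2 + 1 = p - 1 by omega]
  · simp only [add_assoc, add_mul, one_mul, add_comm r]
  · intro s
    simp only [add_right_comm s p, hper _]

theorem mergeColumn_symbolWeight (hp : 2 ≤ p) {α : Type*} (L L' : List α) (f f' : α → ℕ)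
    (hr : r ≤ p) :
    mergeColumn p (7 * L.length) (7 * L'.length) r
        ((List.range p).map fun s => lanes (L.map fun v => symbolWeight p (s + f v)))
        ((List.range p).map fun s => lanes (L'.map fun v => symbolWeight p (s + f' v))) =
      (List.range p).map fun s => lanes (L.map (fun v => symbolWeight p (s + f v)) ++
        (List.range (p - 1)).flatMap fun x =>
          L'.map fun v => symbolWeight p (s + (x + 1) * r + f' v)) := by
  refine mergeColumn_map_lanes hp (fun _ => by rw [List.length_map])
    (fun _ => by rw [List.length_map]) (fun s => ?_) hr
  simp only [symbolWeight, add_right_comm s p, Nat.add_mod_right]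

theorem mergeColumns_map {α : Type*} (p w w' : ℕ) (R : α → ℕ) (T T' : α → List ℕ) (l : List α) :
    mergeColumns p w w' (l.map R) (l.map T) (l.map T') =
      l.map fun j => mergeColumn p w w' (R j) (T j) (T' j) := by
  induction l with
  | nil => rfl
  | cons j l ih => rw [List.map_cons, List.map_cons, List.map_cons, mergeColumns, ih, List.map_cons]

end Columns

section Batches

/-- A list of messages together with the weights of their check symbols, packed into lanes. The
entry `s` of the column `j` holds the weights of the check symbols `j` after `s` has been added to
them. -/
structure Batch where
  size : ℕ
  ones : ℕ
  weights : ℕ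
  columns : List (List ℕ)

/-- The batch of the messages `L` with respect to the rows `A` of length `n`, where `w` is added to
the weight of every message. -/
def batchOfMessages (p n w : ℕ) (A L : List (List ℕ)) : Batch where
  size := L.length
  ones := lanes (L.map fun _ => 1)
  weights := lanes (L.map fun v => w + weight v)
  columns := (List.range n).map fun j => (List.range p).map fun s =>
    lanes (L.map fun v => symbolWeight p (s + dot v A j))

/-- The batch of the messages that consist of `0` and a message of `e`, or of a symbol
`1, …, p - 1` and a message of `e'`. -/
def merge (p : ℕ) (row : List ℕ) (e e' : Batch) : Batch where
  size := e.size + (p - 1) * e'.size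
  ones := join (7 * e.size) e.ones (repeatLanes (7 * e'.size) e'.ones (p - 1))
  weights := join (7 * e.size) e.weights (repeatLanes (7 * e'.size) e'.weights (p - 1))
  columns := mergeColumns p (7 * e.size) (7 * e'.size) row e.columns e'.columns

/-- The batch of `messages`, computed without listing the messages; every step consists of a cap
and a row of length `n`, and `b` is added to all weights. -/
def batch (p n b : ℕ) : List (ℕ × List ℕ) → ℕ → Batch
  | [], a => ⟨1, 1, b + a, List.replicate n (0 :: List.replicate (p - 1) 1)⟩
  | (cap, row) :: steps, a =>
    if a < cap then merge p row (batch p n b steps a) (batch p n b steps (a + 1))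
    else batch p n b steps a

variable {p n : ℕ} {row : List ℕ}

theorem batchOfMessages_map_zero_cons (w : ℕ) (A L : List (List ℕ)) :
    batchOfMessages p n w (row :: A) (L.map (0 :: ·)) = batchOfMessages p n w A L := by
  simp only [batchOfMessages, List.length_map, List.map_map, Function.comp_def, weight_zero_cons,
    dot_cons, zero_mul, zero_add]

theorem batchOfMessages_nil (hp : 0 < p) (w : ℕ) :
    batchOfMessages p n w [] [[]] =
      ⟨1, 1, w, List.replicate n (0 :: List.replicate (p - 1) 1)⟩ := by
  obtain ⟨q, rfl⟩ := Nat.exists_eq_add_one_of_ne_zero hp.ne'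
  have hcolumn : ((List.range (q + 1)).map fun s => symbolWeight (q + 1) s) =
      0 :: List.replicate q 1 := by
    rw [List.range_succ_eq_map, List.map_cons, List.map_map, ← List.length_range (n := q),
      ← List.map_const', List.length_range]
    congr 1
    refine List.map_congr_left fun s hs => ?_
    simp [symbolWeight, Nat.mod_eq_of_lt (Nat.succ_lt_succ (List.mem_range.1 hs))]
  simp [batchOfMessages, weight, dot, lanes, hcolumn]

theorem batchOfMessages_cons (hp : 2 ≤ p) (hlen : row.length = n) (hlt : ∀ x ∈ row, x < p)
    (w : ℕ) (A L L' : List (List ℕ)) :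
    batchOfMessages p n w (row :: A)
        (L.map (0 :: ·) ++ (List.range (p - 1)).flatMap fun x => L'.map ((x + 1) :: ·)) =
      merge p row (batchOfMessages p n w A L) (batchOfMessages p n (w + 1) A L') := by
  have hle : ∀ j, row.getD j 0 ≤ p := fun j => (getD_lt (by omega) hlt j).le
  have hrepeat (f : List ℕ → ℕ) : repeatLanes (7 * L'.length) (lanes (L'.map f)) (p - 1) =
      lanes ((List.range (p - 1)).flatMap fun _ => L'.map f) := by
    rw [← repeatLanes_lanes, List.length_map]
  have hjoin (f : List ℕ → ℕ) (l : List ℕ) : join (7 * L.length) (lanes (L.map f)) (lanes l) =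
      lanes (L.map f ++ l) := by
    rw [lanes_append, List.length_map]
  simp only [merge, batchOfMessages, hrepeat, hjoin]
  conv_rhs => rw [eq_map_getD hlen 0]
  simp only [mergeColumns_map, mergeColumn_symbolWeight hp _ _ _ _ (hle _)]
  simp [List.map_flatMap, Function.comp_def, weight_zero_cons, weight_succ_cons, dot_cons,
    add_assoc, add_comm 1, List.length_flatMap]

theorem batch_eq_batchOfMessages (hp : 2 ≤ p) (b : ℕ) {steps : List (ℕ × List ℕ)}
    (hlen : ∀ step ∈ steps, step.2.length = n) (hlt : ∀ step ∈ steps, ∀ x ∈ step.2, x < p) (a : ℕ) :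
    batch p n b steps a = batchOfMessages p n (b + a) (steps.map Prod.snd)
      (messages p (steps.map Prod.fst) a) := by
  induction steps generalizing a with
  | nil => rw [batch, List.map_nil, List.map_nil, messages, batchOfMessages_nil (by omega)]
  | cons step steps ih =>
    obtain ⟨cap, row⟩ := step
    rw [List.forall_mem_cons] at hlen hlt
    rw [batch, List.map_cons, List.map_cons, messages, ih hlen.2 hlt.2, ih hlen.2 hlt.2]
    split_ifs with ha
    · rw [batchOfMessages_cons hp hlen.1 hlt.1, add_assoc]
    · rw [List.append_nil, batchOfMessages_map_zero_cons]

end Batches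

section Search

/-- The sum of `s` and of the entries of the columns `ts` selected, modulo `p`, by the digits of
`U` in base `1024`. -/
def lookupSum (p : ℕ) (ts : List (List ℕ)) : ℕ → ℕ → ℕ :=
  List.rec (fun _ s => s) (fun t _ ih U s =>
    onValue (fun i => ih (U / 1024) (s + lookup t i)) (U % 1024 % p)) ts

/-- Whether all lanes of the batch are at least `64`, when the digits of `U` in base `1024` are
added to the check symbols. -/
def Batch.check (p : ℕ) (e : Batch) (U : ℕ) : Bool :=
  Nat.beq (lookupSum p e.columns U e.weights &&& 64 * e.ones) (64 * e.ones)

/-- The search through `messages` for weights with a sum less than `64`. The digits of `U` in base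
`1024` are the check symbols of the preceding part of the message, before reduction modulo `p`.
Batches of at most `M` messages are checked at once, and only if `U` is `c` modulo `K`, which
divides the search into `K` parts so that no evaluation needs too much memory. -/
def search (p n b M K c : ℕ) : List (ℕ × List ℕ) → ℕ → ℕ → Bool
  | [], a, U => U % K != c || (batch p n b [] a).check p U
  | (cap, row) :: steps, a, U =>
    if (batch p n b ((cap, row) :: steps) a).size ≤ M then
      U % K != c || (batch p n b ((cap, row) :: steps) a).check p U
    else search p n b M K c steps a U &&
      if a < cap then
        (List.range (p - 1)).all fun x =>
          search p n b M K c steps (a + 1) (U + (x + 1) * Nat.ofDigits 1024 row)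
      else true

/-- The search through the messages with first nonzero symbol `1`. -/
def searchNormalized (p n b M K c : ℕ) : List (ℕ × List ℕ) → Bool
  | [] => true
  | (_, row) :: steps =>
    search p n b M K c steps 1 (Nat.ofDigits 1024 row) && searchNormalized p n b M K c steps

theorem lookupSum_cons (p : ℕ) (t : List ℕ) (ts : List (List ℕ)) (U s : ℕ) :
    lookupSum p (t :: ts) U s = lookupSum p ts (U / 1024) (s + t.getD (U % 1024 % p) 0) := by
  rw [← lookup_eq]
  exact onValue_eq (fun i => lookupSum p ts (U / 1024) (s + lookup t i)) _

variable {p n : ℕ}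

theorem lookupSum_map {α : Type*} (hp : 0 < p) {D : α → ℕ} (T : α → ℕ → ℕ) {l : List α}
    (hD : ∀ j ∈ l, D j < 1024) (s : ℕ) :
    lookupSum p (l.map fun j => (List.range p).map (T j)) (Nat.ofDigits 1024 (l.map D)) s =
      s + (l.map fun j => T j (D j % p)).sum := by
  induction l generalizing s with
  | nil => rfl
  | cons j l ih =>
    rw [List.forall_mem_cons] at hD
    simp only [List.map_cons, List.sum_cons, lookupSum_cons, Nat.ofDigits_cons,
      Nat.add_mul_mod_self_left, Nat.add_mul_div_left _ _ (Nat.succ_pos 1023),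
      Nat.mod_eq_of_lt hD.1, Nat.div_eq_of_lt hD.1, zero_add, ih hD.2]
    rw [List.getD_eq_getElem _ _ (by simpa using Nat.mod_lt _ hp)]
    simp [add_assoc]

theorem encodedWeight_le (p n : ℕ) (A : List (List ℕ)) (D : ℕ → ℕ) (v : List ℕ) :
    encodedWeight p n A D v ≤ v.length + n := by
  refine Nat.add_le_add List.countP_le_length ?_
  calc ∑ j ∈ Finset.range n, symbolWeight p (D j + dot v A j)
      ≤ ∑ _j ∈ Finset.range n, 1 := Finset.sum_le_sum fun j _ => by
        rw [symbolWeight]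
        split_ifs <;> omega
    _ = n := by simp

theorem encodedWeight_zero_cons (row : List ℕ) (A : List (List ℕ)) (D : ℕ → ℕ) (v : List ℕ) :
    encodedWeight p n (row :: A) D (0 :: v) = encodedWeight p n A D v := by
  simp only [encodedWeight, weight_zero_cons, dot_cons, zero_mul, zero_add]

theorem encodedWeight_succ_cons (row : List ℕ) (A : List (List ℕ)) (D : ℕ → ℕ) (x : ℕ)
    (v : List ℕ) : encodedWeight p n (row :: A) D ((x + 1) :: v) =
      encodedWeight p n A (fun j => D j + (x + 1) * row.getD j 0) v + 1 := by
  simp only [encodedWeight, weight_succ_cons, dot_cons, add_assoc, add_comm 1]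

theorem le_of_check {w : ℕ} {A L : List (List ℕ)} {D : ℕ → ℕ} (hp : 0 < p)
    (hD : ∀ j < n, D j < 1024) (hL : ∀ v ∈ L, w + (v.length + n) < 128)
    (h : (batchOfMessages p n w A L).check p (Nat.ofDigits 1024 ((List.range n).map D)) = true) :
    ∀ v ∈ L, 64 ≤ w + encodedWeight p n A D v := by
  have hsum : lookupSum p (batchOfMessages p n w A L).columns
      (Nat.ofDigits 1024 ((List.range n).map D)) (batchOfMessages p n w A L).weights =
        lanes (L.map fun v => w + encodedWeight p n A D v) := by
    rw [batchOfMessages, lookupSum_map hp _ (by simpa using hD), lanes_map_add_sum]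
    simp only [symbolWeight, Nat.mod_add_mod, add_assoc]
    rfl
  have hland := Nat.eq_of_beq_eq_true h
  rw [hsum] at hland
  have hlanes := le_of_land_lanes (l := L.map fun v => w + encodedWeight p n A D v) ?_ ?_
  · simpa using hlanes
  · simp only [List.mem_map]
    rintro _ ⟨v, hv, rfl⟩
    exact (Nat.add_le_add_left (encodedWeight_le p n A D v) w).trans_lt (hL v hv)
  · rwa [List.map_map]

variable {b M K : ℕ} {steps : List (ℕ × List ℕ)}

theorem le_of_batch_check (hp : 2 ≤ p) (hK : 0 < K) (hlen : ∀ step ∈ steps, step.2.length = n)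
    (hlt : ∀ step ∈ steps, ∀ x ∈ step.2, x < p) {a : ℕ} (hb : b + a + (steps.length + n) < 128)
    {D : ℕ → ℕ} (hD : ∀ j < n, D j < 1024) {U : ℕ}
    (hU : U = Nat.ofDigits 1024 ((List.range n).map D))
    (h : ∀ c < K, (U % K != c || (batch p n b steps a).check p U) = true) :
    ∀ v ∈ messages p (steps.map Prod.fst) a,
      64 ≤ b + a + encodedWeight p n (steps.map Prod.snd) D v := by
  have hcheck := h (U % K) (Nat.mod_lt _ hK)
  rw [bne_self_eq_false, Bool.false_or, batch_eq_batchOfMessages hp b hlen hlt, hU] at hcheck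
  refine le_of_check (by omega) hD (fun v hv => ?_) hcheck
  rwa [length_of_mem_messages hv, List.length_map]

theorem ofDigits_add_mul_row {row : List ℕ} (hrow : row.length = n) (D : ℕ → ℕ) (x : ℕ) :
    Nat.ofDigits 1024 ((List.range n).map D) + x * Nat.ofDigits 1024 row =
      Nat.ofDigits 1024 ((List.range n).map fun j => D j + x * row.getD j 0) := by
  rw [ofDigits_map_add_mul, ← eq_map_getD hrow 0]

theorem mul_getD_le {row : List ℕ} {x : ℕ} (hx : x < p) (hrow : ∀ y ∈ row, y < p) (j : ℕ) :
    x * row.getD j 0 ≤ (p - 1) ^ 2 := by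
  rw [sq]
  exact Nat.mul_le_mul (Nat.le_sub_one_of_lt hx)
    (Nat.le_sub_one_of_lt (getD_lt (Nat.zero_lt_of_lt hx) hrow j))

theorem le_of_search (hp : 2 ≤ p) (hK : 0 < K) (hlen : ∀ step ∈ steps, step.2.length = n)
    (hlt : ∀ step ∈ steps, ∀ x ∈ step.2, x < p) {a : ℕ} (hb : b + a + (steps.length + n) < 128)
    {D : ℕ → ℕ} (hD : ∀ j < n, D j + (p - 1) ^ 2 * steps.length < 1024) {U : ℕ}
    (hU : U = Nat.ofDigits 1024 ((List.range n).map D))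
    (h : ∀ c < K, search p n b M K c steps a U = true) :
    ∀ v ∈ messages p (steps.map Prod.fst) a,
      64 ≤ b + a + encodedWeight p n (steps.map Prod.snd) D v := by
  have hD' : ∀ j < n, D j < 1024 := fun j hj => (Nat.le_add_right _ _).trans_lt (hD j hj)
  induction steps generalizing a D U with
  | nil => exact le_of_batch_check hp hK hlen hlt hb hD' hU h
  | cons step steps ih =>
    obtain ⟨cap, row⟩ := step
    by_cases hM : (batch p n b ((cap, row) :: steps) a).size ≤ M
    · simp only [search, if_pos hM] at h
      exact le_of_batch_check hp hK hlen hlt hb hD' hU h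
    obtain ⟨hrow : row.length = n, hlen⟩ := List.forall_mem_cons.1 hlen
    obtain ⟨hrowlt : ∀ y ∈ row, y < p, hlt⟩ := List.forall_mem_cons.1 hlt
    simp only [List.length_cons, mul_add_one] at hb hD
    simp only [search, if_neg hM, Bool.and_eq_true] at h
    intro v hv
    obtain ⟨v', hv', rfl⟩ | ⟨ha, x, hx, v', hv', rfl⟩ := mem_messages_cons.1 hv
    · rw [List.map_cons, encodedWeight_zero_cons]
      refine ih hlen hlt (by omega) (fun j hj => ?_) hU (fun c hc => (h c hc).1) hD' v' hv'
      have := hD j hj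
      omega
    · have hD'' (j) (hj : j < n) :
          D j + (x + 1) * row.getD j 0 + (p - 1) ^ 2 * steps.length < 1024 := by
        have := mul_getD_le (Nat.add_lt_of_lt_sub hx) hrowlt j
        have := hD j hj
        omega
      have hsearch (c) (hc : c < K) := (h c hc).2
      simp only [if_pos ha, List.all_eq_true, List.mem_range] at hsearch
      have hle := ih hlen hlt (a := a + 1) (by omega) hD'' (by rw [hU, ofDigits_add_mul_row hrow])
        (fun c hc => hsearch c hc x hx)
        (fun j hj => (Nat.le_add_right _ _).trans_lt (hD'' j hj)) v' hv'
      rwa [List.map_cons, encodedWeight_succ_cons, add_comm _ 1, ← add_assoc, add_assoc b]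

theorem le_of_searchNormalized (hp : 2 ≤ p) (hK : 0 < K)
    (hlen : ∀ step ∈ steps, step.2.length = n) (hlt : ∀ step ∈ steps, ∀ x ∈ step.2, x < p)
    (hb : b + (steps.length + n) < 128) (hD : (p - 1) ^ 2 * steps.length < 1024)
    (h : ∀ c < K, searchNormalized p n b M K c steps = true) {v : List ℕ}
    (hv : v ∈ messages p (steps.map Prod.fst) 0) (hone : v.find? (· ≠ 0) = some 1) :
    64 ≤ b + encodedWeight p n (steps.map Prod.snd) 0 v := by
  induction steps generalizing v with
  | nil => simp_all [messages]
  | cons step steps ih =>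
    obtain ⟨cap, row⟩ := step
    obtain ⟨hrow : row.length = n, hlen⟩ := List.forall_mem_cons.1 hlen
    obtain ⟨hrowlt : ∀ y ∈ row, y < p, hlt⟩ := List.forall_mem_cons.1 hlt
    simp only [List.length_cons, mul_add_one] at hb hD
    simp only [searchNormalized, Bool.and_eq_true] at h
    obtain ⟨v', hv', rfl⟩ | ⟨-, x, -, v', hv', rfl⟩ := mem_messages_cons.1 hv
    · rw [List.map_cons, encodedWeight_zero_cons]
      exact ih hlen hlt (by omega) (by omega) (fun c hc => (h c hc).2) hv' (by simpa using hone)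
    · obtain rfl : x = 0 := by simpa using hone
      rw [List.map_cons, encodedWeight_succ_cons]
      have hle := le_of_search hp hK hlen hlt (a := 1) (D := fun j => row.getD j 0) (by omega)
        (fun j _ => ?_) (by rw [← eq_map_getD hrow 0]) (fun c hc => (h c hc).1) v' hv'
      · simpa [add_assoc, add_comm 1] using hle
      · have := mul_getD_le hp hrowlt j
        omega

end Search

section Certificate

variable {p m ℓ k d M K : ℕ} [Fact p.Prime] [NeZero m] [NeZero ℓ] {g : Fin ℓ → List (ZMod p)}
  {A B : List (List ℕ)}

theorem message_eq {c : Fin ℓ × Fin m → ZMod p} {v : List ℕ} (hv : v.length = k)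
    (hlt : ∀ x ∈ v, x < p) (h : ∀ i < k, coord c i = (v.getD i 0 : ZMod p)) : message k c = v := by
  rw [eq_map_getD hv 0, message]
  refine List.map_congr_left fun i hi => ?_
  rw [h i (List.mem_range.1 hi), ZMod.val_natCast,
    Nat.mod_eq_of_lt (getD_lt (NeZero.pos p) hlt i)]

theorem exists_hammingNorm_eq {C : Submodule (ZMod p) (Fin ℓ × Fin m → ZMod p)}
    (hA : A.length = k) (hC : IsSystematic C k fun i t => (entry A i t : ZMod p)) {v : List ℕ}
    (hv : v.length = k) (hlt : ∀ x ∈ v, x < p) :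
    ∃ c ∈ C, hammingNorm c = encodedWeight p (m * ℓ - k) A 0 v := by
  obtain ⟨c, hc, hcoord⟩ := hC.exists_coord_eq fun i => (v.getD i 0 : ZMod p)
  exact ⟨c, hc, by rw [hammingNorm_eq_encodedWeight hA hC hc, message_eq hv hlt hcoord]⟩

theorem le_hammingNorm_of_search (hn : m * ℓ < 64 + d) (hd : d ≤ 64) (hpk : (p - 1) ^ 2 * k < 1024)
    (hA : A.length = k) (hrow : ∀ row ∈ A, row.length = m * ℓ - k)
    (hlt : ∀ row ∈ A, ∀ x ∈ row, x < p)
    (hC : IsSystematic (blockCode m 1 g) k fun i t => (entry A i t : ZMod p)) (hK : 0 < K)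
    (h : ∀ i < K, searchNormalized p (m * ℓ - k) (64 - d) M K i
      ((weightCaps m ℓ k d).zip A) = true) {c : Fin ℓ × Fin m → ZMod p}
    (hc : c ∈ blockCode m 1 g) (h0 : c ≠ 0) : d ≤ hammingNorm c := by
  by_contra! hcd
  obtain ⟨c', hc', hnorm, hprefix, f, hf, hone, hzero⟩ :=
    hC.exists_normalized (fun r c => rotate_mem_blockCode r) hc h0
  have hcaps : (weightCaps m ℓ k d).length = k := by simp [weightCaps]
  have hfst : ((weightCaps m ℓ k d).zip A).map Prod.fst = weightCaps m ℓ k d :=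
    List.map_fst_zip (by rw [hcaps, hA])
  have hsnd : ((weightCaps m ℓ k d).zip A).map Prod.snd = A :=
    List.map_snd_zip (by rw [hcaps, hA])
  have hlen : ((weightCaps m ℓ k d).zip A).length = k := by
    rw [List.length_zip, hcaps, hA, min_self]
  have hle := le_of_searchNormalized (Fact.out : p.Prime).two_le hK
    (fun step hstep => hrow _ (List.of_mem_zip hstep).2)
    (fun step hstep => hlt _ (List.of_mem_zip hstep).2)
    (by have := hC.le_length; omega) (by rwa [hlen]) h
    (v := message k c')
    (by
      rw [hfst]
      exact message_mem_messages fun i => (hprefix i).trans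
        (Nat.mul_le_mul_left i (Nat.le_sub_one_of_lt hcd)))
    (find?_message hf hone hzero)
  rw [hsnd, ← hammingNorm_eq_encodedWeight hA hC hc'] at hle
  omega

theorem hasParameters_of_search {v : List ℕ} (hk : k ≤ m) (hn : m * ℓ < 64 + d) (hd : 0 < d)
    (hd' : d ≤ 64) (hpk : (p - 1) ^ 2 * k < 1024) (hA : A.length = k)
    (hrow : ∀ row ∈ A, row.length = m * ℓ - k) (hlt : ∀ row ∈ A, ∀ x ∈ row, x < p)
    (hsys : checkSystematic m g k A = true) (hinv : checkInverse m g k B = true)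
    (hv : v.length = k) (hvlt : ∀ x ∈ v, x < p) (hvd : encodedWeight p (m * ℓ - k) A 0 v = d)
    (hK : 0 < K)
    (h : ∀ i < K, searchNormalized p (m * ℓ - k) (64 - d) M K i
      ((weightCaps m ℓ k d).zip A) = true) :
    HasParameters (blockCode m 1 g) (m * ℓ) k d := by
  have hC := isSystematic_of_check hk hA hsys hinv
  refine hasParameters_of_hammingNorm (by simp [mul_comm]) hC.finrank_eq
    (fun c => le_hammingNorm_of_search hn hd' hpk hA hrow hlt hC hK h) ?_
  obtain ⟨c, hc, hnorm⟩ := exists_hammingNorm_eq hA hC hv hvlt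
  rw [hvd] at hnorm
  exact ⟨c, hc, by rw [← hammingNorm_ne_zero_iff]; omega, hnorm⟩

end Certificate

/-- The last `n` decimal digits of a number, starting with the most significant one; used to write
rows of symbols as numerals. -/
def decimalDigits : ℕ → ℕ → List ℕ
  | 0, _ => []
  | n + 1, x => x / 10 ^ n % 10 :: decimalDigits n x

/-- The check symbols of the systematic generator matrix of the code of length 85. -/
def checkRows85 : List (List ℕ) :=
  [141224113143321313224142100333200003314322420230300112344343200104210,
   300233431232024314001044130101202241002124340144322013320230323040334,
   014324240014340400241204012032310343114004011301413424231414421000002,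
   131032441213122134020003324424114301402043024432200203201033104302404,
   412314224023220311030432011204441113041044440212440303110323232430324,
   201114022242403313312220033144021141432111442334003320213002320120432,
   233133041334122402314013233220230301344200341041312042433023124431011,
   231432200201010021444243440142343102121403310121333413414101400334122,
   321223412442434224440443013012041210244314341210403023203304022231201,
   400330111443443201013123441301300132444230124304313033101242324211214,
   220324424303224344311340000011132113024322200440301340313400440114043,
   444421011103244213111333430024030103031001033230103123122024131212112,
   042222001314244210303423100423243004111221010003430024434434331343314,
   002311403242442120322104044232322241324130031100034224321042141323040,
   422341412323342244340410124121223000111431131210040230023330330412124,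
   114111300032403234000102434040443321443403412432001103410414210002012].map (decimalDigits 69)

/-- The coefficients of the systematic generator matrix of the code of length 85 with
respect to the first rows of its block matrix. -/
def inverse85 : List (List ℕ) :=
  [3312110331010203, 2130330024044122, 4303234432434333, 3040224011021024, 2004323210130242,
   3042131404033234, 2433040102122234, 3104404240200221, 3002020111244044, 3222223213212013,
   1121130123200420, 0304313043203402, 3122121120342234, 0300022241323041, 3010240133340210,
   1423143131030314].map (decimalDigits 16)

/-- The message of a word of minimum weight of the code of length 85. -/
def light85 : List ℕ := [0, 3, 3, 2, 1, 0, 0, 0, 0, 0, 0, 3, 2, 0, 2, 0]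

theorem searchNormalized_g85 : ∀ i < 3, searchNormalized 5 69 19 200000 3 i
    ((weightCaps 17 5 16 45).zip checkRows85) = true := by
  intro i hi
  interval_cases i <;> decide +kernel

theorem hasParameters_g85 : HasParameters (blockCode 17 1 g85) 85 16 45 := by
  refine hasParameters_of_search (A := checkRows85) (B := inverse85) (v := light85)
    ?_ ?_ ?_ ?_ ?_ ?_ ?_ ?_ ?_ ?_ ?_ ?_ ?_ (by decide) searchNormalized_g85
  all_goals decide +kernel

/-- The check symbols of the systematic generator matrix of the first code of length 84. -/
def checkRows84 : List (List ℕ) :=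
  [04103114200032322102241023440022034412020120200122113324202204330,
   40143114022121013204323002302224402233241420142201411204132104114,
   20012213002204244412020140210442342332112322121211314331031344332,
   44022140410012121113041124002230230132341202241301210031044143023,
   24303113004042224001032421011033414130012201133411010040200400332,
   33024441402121403200214432230321242424231404320020323411203312122,
   41311024144403204022231211424300041402222311421001204403323402200,
   41220434430121404313030303021020012442411234210143103114423100401,
   42213344034421111223004144212413121102432031214330311104242120331,
   44201424203143040202103110442321133304210320034023432121320314012,
   22122240213213330223434233242210123324223242102001112134332231012,
   01120141100002404231213231330341324102144414024321210033404403401,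
   31232220412031220220212410431413444200420420433144113010342112021,
   01101141020234200323214400042214014034111320234312331324400311043,
   03403210202321123103334042324000040114123131121330413004002214120,
   04322304021233031030132040403111214002300122242041304432040204141,
   23311444413122110041114231044040324334420011214131310230401410024,
   04403444231343132401343131214334444030122012430214002202444211024,
   24041424000033113241243124122201403124121023234111212004413422333].map (decimalDigits 65)

/-- The coefficients of the systematic generator matrix of the first code of length 84 with
respect to the first rows of its block matrix. -/
def inverse84 : List (List ℕ) :=
  [4231230210130342340, 2023411424014141023, 0404213130404314442, 3413044144143324441,
   3443041234414121344, 3122144140414323121, 4041113140012232024, 0122222203403332423,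
   2411113042130223221, 0214440133244402004, 2100033200422011230, 2320342203414303022,
   2023211114342404102, 2131032014423434420, 0314132302332012114, 4001113222224133311,
   1431303244130021412, 2202114304442403321, 1040410410100433303].map (decimalDigits 19)

/-- The message of a word of minimum weight of the first code of length 84. -/
def light84 : List ℕ := [0, 4, 1, 0, 0, 1, 0, 2, 0, 1, 0, 4, 0, 2, 1, 2, 0, 1, 0]

set_option maxHeartbeats 1600000 in
-- Each of the nine evaluations is a large computation in the kernel.
theorem searchNormalized_g84 : ∀ i < 9, searchNormalized 5 65 23 200000 9 i
    ((weightCaps 21 4 19 41).zip checkRows84) = true := by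
  intro i hi
  interval_cases i <;> decide +kernel

theorem hasParameters_g84 : HasParameters (blockCode 21 1 g84) 84 19 41 := by
  refine hasParameters_of_search (A := checkRows84) (B := inverse84) (v := light84)
    ?_ ?_ ?_ ?_ ?_ ?_ ?_ ?_ ?_ ?_ ?_ ?_ ?_ (by decide) searchNormalized_g84
  all_goals decide +kernel

/-- The check symbols of the systematic generator matrix of the second code of length 84. -/
def checkRows84' : List (List ℕ) :=
  [32203111231030243343041033232113433042420104033411341020443441302040403,
   14303401442221031142104144011423203200400111421432411031240023030123124,
   32030444430331202112310300343202431320004223332332042114002031332333312,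
   21030224200042322021302101032202401343113124430332122012423200022103223,
   12432442112043120240300000112432314412440214431331010000403312031332000,
   21132223334221412143121430341404221403242331413211241033233203422102212,
   22042043403211303324331343111401223402320334042230443410310144234311013,
   40004104013344041110131310121032241412330114410322441144101040430343002,
   34431444211002422431114343142430413144421003024324012010234131444033412,
   13202412103233401232444201100032433201412131443023341022002010023210221,
   23042203313232101134230334100113012221401441134231301110222311403422401,
   23241411021222214301210003110344103033313404143004012043204022013420140,
   03400403133400300134313201411310421304103224023033143141040332410140023].map (decimalDigits 71)

/-- The coefficients of the systematic generator matrix of the second code of length 84 with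
respect to the first rows of its block matrix. -/
def inverse84' : List (List ℕ) :=
  [1133322403440, 2204121010043, 0220130244200, 4203223432310, 2413030212242, 3134130323232,
   2223331223001, 2411232300243, 1301200234100, 3223024231101, 4243202242413, 1101133422140,
   3203340042003].map (decimalDigits 13)

/-- The message of a word of minimum weight of the second code of length 84. -/
def light84' : List ℕ := [0, 0, 3, 0, 2, 1, 0, 4, 1, 4, 2, 0, 0]

theorem searchNormalized_g84' : ∀ i < 1, searchNormalized 5 71 16 50000 1 i
    ((weightCaps 14 6 13 48).zip checkRows84') = true := by
  intro i hi
  interval_cases i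
  decide +kernel

theorem hasParameters_g84' : HasParameters (blockCode 14 1 g84') 84 13 48 := by
  refine hasParameters_of_search (A := checkRows84') (B := inverse84') (v := light84')
    ?_ ?_ ?_ ?_ ?_ ?_ ?_ ?_ ?_ ?_ ?_ ?_ ?_ one_pos searchNormalized_g84'
  all_goals decide +kernel

/-- The check symbols of the systematic generator matrix of the code of length 65. -/
def checkRows65 : List (List ℕ) :=
  [53656610452662236024644143102030244053554132142404660,
   43052152663204046426415014663001265030345620233661061,
   16346533032221104403554445233013454145656452165531244,
   44230412023532624225405355104551013134155530215252155,
   42334226640145244553021265112165004604012463510625505,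
   35515313216055524330303220443221351524655430066000012,
   12500451463601502010300413351561625265232652063342515,
   31541415441422501401114415520166163602600045560140225,
   36513064406552063521221313663341346403150052251360242,
   12005164561061633214353131400165225625103536102444315,
   26656205320164532001503342411240425355413330026352216,
   61026643515605533145250645333502136511151114504426250].map (decimalDigits 53)

/-- The coefficients of the systematic generator matrix of the code of length 65 with
respect to the first rows of its block matrix. -/
def inverse65 : List (List ℕ) :=
  [440601223534, 353163223614, 036536551140, 466442026104, 035211054046, 230166140511,
   116611620602, 440211210224, 665523053152, 614326502263, 230511523535,
   002231430263].map (decimalDigits 12)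

/-- The message of a word of minimum weight of the code of length 65. -/
def light65 : List ℕ := [0, 5, 3, 3, 0, 0, 2, 1, 6, 5, 0, 0]

theorem searchNormalized_g65 : ∀ i < 1, searchNormalized 7 53 25 20000 1 i
    ((weightCaps 13 5 12 39).zip checkRows65) = true := by
  intro i hi
  interval_cases i
  decide +kernel

theorem hasParameters_g65 : HasParameters (blockCode 13 1 g65) 65 12 39 := by
  refine hasParameters_of_search (A := checkRows65) (B := inverse65) (v := light65)
    ?_ ?_ ?_ ?_ ?_ ?_ ?_ ?_ ?_ ?_ ?_ ?_ ?_ one_pos searchNormalized_g65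
  all_goals decide +kernel

/-- The check symbols of the systematic generator matrix of the code of length 78. -/
def checkRows78 : List (List ℕ) :=
  [14433650021166243006611131215054451246521403334650430266106506443,
   25242316120243501240166542342125510145356221652104164612532615242,
   15344610651046643263535051464623324631506302512352346030120330026,
   56510345530350343423444364200333266543660565365154264062066525563,
   13153462630260315531213005313205064445341316644602263310443354152,
   50543105616610512215125345431252325366515360511260034114334501505,
   65023103462524650334642230330222315012314005010652555236356320514,
   56555546210430306012264005553525501305430225535426333403514033435,
   12613162110621562015342133230231165641620615642050002243141142030,
   32614415630512541363236031524106134130261526035244031034541251066,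
   56250264255161065061060331361331234642332064610356053216002060430,
   01451016042064615214153213646006560223264326162456004113051020306,
   31160252654220645356235531014356156240634052404363222263424401465].map (decimalDigits 65)

/-- The coefficients of the systematic generator matrix of the code of length 78 with
respect to the first rows of its block matrix. -/
def inverse78 : List (List ℕ) :=
  [1044342530234, 2414402306330, 3531025652563, 6350125465563, 2212031101226, 0252262663134,
   5106034120611, 6435456666233, 4305324632500, 0343123500116, 0120302332620, 1562035536051,
   4045401111631].map (decimalDigits 13)

/-- The message of a word of minimum weight of the code of length 78. -/
def light78 : List ℕ := [0, 5, 2, 0, 1, 5, 0, 5, 0, 0, 1, 3, 0]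

theorem searchNormalized_g78 : ∀ i < 6, searchNormalized 7 65 17 200000 6 i
    ((weightCaps 13 6 13 47).zip checkRows78) = true := by
  intro i hi
  interval_cases i <;> decide +kernel

theorem hasParameters_g78 : HasParameters (blockCode 13 1 g78) 78 13 47 := by
  refine hasParameters_of_search (A := checkRows78) (B := inverse78) (v := light78)
    ?_ ?_ ?_ ?_ ?_ ?_ ?_ ?_ ?_ ?_ ?_ ?_ ?_ (by decide) searchNormalized_g78
  all_goals decide +kernel

end QTCode

theorem mainTheorem2 :
    (QTCode.IsQuasiTwisted 5 1 (QTCode.interleave (QTCode.blockCode 17 1 QTCode.g85)) ∧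
      QTCode.HasParameters (QTCode.blockCode 17 1 QTCode.g85) 85 16 45) ∧
    (QTCode.IsQuasiTwisted 4 1 (QTCode.interleave (QTCode.blockCode 21 1 QTCode.g84)) ∧
      QTCode.HasParameters (QTCode.blockCode 21 1 QTCode.g84) 84 19 41) ∧
    (QTCode.IsQuasiTwisted 6 1 (QTCode.interleave (QTCode.blockCode 14 1 QTCode.g84')) ∧
      QTCode.HasParameters (QTCode.blockCode 14 1 QTCode.g84') 84 13 48) ∧
    (QTCode.IsQuasiTwisted 5 1 (QTCode.interleave (QTCode.blockCode 13 1 QTCode.g65)) ∧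
      QTCode.HasParameters (QTCode.blockCode 13 1 QTCode.g65) 65 12 39) ∧
    (QTCode.IsQuasiTwisted 6 1 (QTCode.interleave (QTCode.blockCode 13 1 QTCode.g78)) ∧
      QTCode.HasParameters (QTCode.blockCode 13 1 QTCode.g78) 78 13 47) := by
  refine ⟨⟨?_, QTCode.hasParameters_g85⟩, ⟨?_, QTCode.hasParameters_g84⟩,
    ⟨?_, QTCode.hasParameters_g84'⟩, ⟨?_, QTCode.hasParameters_g65⟩, ⟨?_, QTCode.hasParameters_g78⟩⟩
  all_goals exact QTCode.isQuasiTwisted_interleave_blockCode one_ne_zero (by decide) _
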